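/- Let $\mathbb T=\mathbb R\cup\{\infty\}$, with $\oplus=\min$ and $\odot=+$. Write $[2n]=\{1,\dots,n,\bar 1,\dots,\bar n\}$ with the involution $i\leftrightarrow\bar i$ (so $\bar{\bar i}=i$), $Si=S\cup\{i\}$, and let $\binom{E}{k}$ be the set of $k$-element subsets of $E$. "A.A.T." means that the minimum of the given finite family is achieved at least twice or is equal to $\infty$. A valuated matroid $\mu\in \mathrm{Dr}(k,2n)$ is a vector $\mu\in\mathbb T^{\binom{[2n]}{k}}\setminus\{(\infty,\dots,\infty)\}$, modulo adding real multiples of $(1,\dots,1)$, such that for all $S\in\binom{[2n]}{k-1}$ and $T\in\binom{[2n]}{k+1}$ the minimum in $\bigoplus_{i\in T\setminus S}\mu_{T\setminus i}\odot\mu_{Si}$ is A.A.T. Its tropical linear space is $$L_\mu=\Big\{x\in\mathbb T^{2n}\ \Big|\ \text{for all } T\in\tbinom{[2n]}{k+1},\ \text{the minimum in } \bigoplus_{i\in T}\mu_{T\setminus i}\odot x_i \text{ is A.A.T.}\Big\}.$$ It is called isotropic if for all $x,y\in L_\mu$ the minimum in $\bigoplus_{i\in[2n]}x_i\odot y_{\bar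 i}$ is A.A.T. The symplectic Dressian $\mathrm{SpDr}(k,2n)$ is the set of all $\mu\in\mathrm{Dr}(k,2n)$ such that for all $S\in\binom{[2n]}{k-2}$ the minimum in $\bigoplus_{i}\mu_{Si\bar i}$, over all $i\in[n]$ with $\{i,\bar i\}\cap S=\emptyset$, is A.A.T. (no condition if $k<2$). **Proposition.** Let $n\le 3$ and let $\mu\in\mathrm{Dr}(n,2n)$. Then $L_\mu$ is isotropic if and only if $\mu\in\mathrm{SpDr}(n,2n)$. -/

import Mathlib

/-- The tropical numbers `ℝ ∪ {∞}`: tropical addition is `min` (so that a tropical sum is a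
`Finset.inf`), tropical multiplication is `+`. -/
abbrev TropNum : Type := WithTop ℝ

/-- The minimum of the family `(f i)_{i ∈ s}` is achieved at least twice, or is equal to `∞`. -/
def MinTwice {ι : Type*} (s : Finset ι) (f : ι → TropNum) : Prop :=
  s.inf f = ⊤ ∨ ∃ i ∈ s, ∃ j ∈ s, i ≠ j ∧ f i = s.inf f ∧ f j = s.inf f

/-- Two vectors of tropical numbers, not identically `∞`, are identified if they differ by a real
multiple of `(1, …, 1)`. -/
def tropProjSetoid (ι : Type*) : Setoid {v : ι → TropNum // ∃ i, v i ≠ ⊤} where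
  r v w := ∃ c : ℝ, ∀ i, w.1 i = (c : TropNum) + v.1 i
  iseqv :=
    { refl := fun v => ⟨0, fun i => by simp⟩
      symm := by
        rintro v w ⟨c, h⟩
        refine ⟨-c, fun i => ?_⟩
        rw [h i, ← add_assoc, ← WithTop.coe_add]
        simp
      trans := by
        rintro u v w ⟨c, h⟩ ⟨d, h'⟩
        refine ⟨d + c, fun i => ?_⟩
        rw [h' i, h i, ← add_assoc, ← WithTop.coe_add] }

/-- Tropical projective space `(𝕋^ι ∖ {(∞, …, ∞)}) / ℝ(1, …, 1)`. -/
def TropProj (ι : Type*) : Type _ := Quotient (tropProjSetoid ι)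

/-- The `k`-element subsets of `E`, which index the Plücker coordinates. -/
abbrev KSubset (k : ℕ) (E : Type*) : Type _ := {J : Finset E // J.card = k}

/-- The coordinate `v_J` of a vector indexed by `k`-element subsets. It is only ever used for sets
`J` with `k` elements, the value at other sets is irrelevant. -/
def plCoord {k : ℕ} {E : Type*} (v : KSubset k E → TropNum) (J : Finset E) : TropNum :=
  if h : J.card = k then v ⟨J, h⟩ else ⊤

/-- The tropical Plücker relations. -/
def TropPluckerRel {k : ℕ} {E : Type*} [DecidableEq E] (v : KSubset k E → TropNum) : Prop :=
  ∀ S T : Finset E, S.card + 1 = k → T.card = k + 1 →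
    MinTwice (T \ S) (fun i => plCoord v (T.erase i) + plCoord v (insert i S))

/-- The point set in `𝕋^E` cut out by the tropical linear forms `⨁_{i ∈ T} v_{T ∖ i} ⊙ x_i`, where
`T` ranges over the `(k+1)`-element subsets of `E`. -/
def tropLinSet {k : ℕ} {E : Type*} [DecidableEq E] (v : KSubset k E → TropNum) :
    Set (E → TropNum) :=
  {x | ∀ T : Finset E, T.card = k + 1 → MinTwice T (fun i => plCoord v (T.erase i) + x i)}

/-- The involution `i ↦ ī` of `[2n] = {1, …, n, 1̄, …, n̄}`, realized as `Fin n ⊕ Fin n`. -/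
def barInv {n : ℕ} (i : Fin n ⊕ Fin n) : Fin n ⊕ Fin n := i.swap

/-- The tropical symplectic relations: for every `S` with `k - 2` elements (there is none if
`k < 2`), the minimum of the `v_{S i ī}`, over the `i ∈ [n]` with `{i, ī} ∩ S = ∅`, is achieved at
least twice. -/
def TropSymplecticRel {k n : ℕ} (v : KSubset k (Fin n ⊕ Fin n) → TropNum) : Prop :=
  ∀ S : Finset (Fin n ⊕ Fin n), S.card + 2 = k →
    MinTwice {i : Fin n | Sum.inl i ∉ S ∧ barInv (Sum.inl i) ∉ S}
      (fun i => plCoord v (insert (Sum.inl i) (insert (barInv (Sum.inl i)) S)))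

/- The conditions above do not depend on the representative of a point of projective space. -/

theorem minTwice_const_add {ι : Type*} {s : Finset ι} {f : ι → TropNum} (c : ℝ)
    (h : MinTwice s f) : MinTwice s (fun i => (c : TropNum) + f i) := by
  have hinf : s.inf (fun i => (c : TropNum) + f i) = (c : TropNum) + s.inf f := by
    have hmono : Monotone (fun a : TropNum => (c : TropNum) + a) :=
      fun a b hab => by simpa using add_le_add_right hab (c : TropNum)
    exact (Finset.apply_inf_eq_inf_comp (fun a : TropNum => (c : TropNum) + a)
      (fun a b => hmono.map_min) (by simp)).symm
  unfold MinTwice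
  rw [hinf]
  rcases h with h | ⟨i, hi, j, hj, hij, h1, h2⟩
  · left
    rw [h]
    simp
  · right
    exact ⟨i, hi, j, hj, hij, by simp only [h1], by simp only [h2]⟩

theorem plCoord_const_add {k : ℕ} {E : Type*} {v w : KSubset k E → TropNum} {c : ℝ}
    (h : ∀ J, w J = (c : TropNum) + v J) (J : Finset E) :
    plCoord w J = (c : TropNum) + plCoord v J := by
  unfold plCoord
  split_ifs with hJ
  · exact h _
  · simp

theorem tropPluckerRel_of_equiv {k : ℕ} {E : Type*} [DecidableEq E]
    {v w : KSubset k E → TropNum} {c : ℝ} (h : ∀ J, w J = (c : TropNum) + v J)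
    (hv : TropPluckerRel v) : TropPluckerRel w := by
  intro S T hS hT
  have := minTwice_const_add (c + c) (hv S T hS hT)
  simp only [plCoord_const_add h]
  convert this using 2 with i
  rw [WithTop.coe_add]
  exact add_add_add_comm _ _ _ _

theorem tropSymplecticRel_of_equiv {k n : ℕ} {v w : KSubset k (Fin n ⊕ Fin n) → TropNum} {c : ℝ}
    (h : ∀ J, w J = (c : TropNum) + v J) (hv : TropSymplecticRel v) : TropSymplecticRel w := by
  intro S hS
  simp only [plCoord_const_add h]
  exact minTwice_const_add c (hv S hS)

theorem tropLinSet_subset_of_equiv {k : ℕ} {E : Type*} [DecidableEq E]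
    {v w : KSubset k E → TropNum} {c : ℝ} (h : ∀ J, w J = (c : TropNum) + v J) :
    tropLinSet v ⊆ tropLinSet w := by
  intro x hx T hT
  simp only [plCoord_const_add h, add_assoc]
  exact minTwice_const_add c (hx T hT)

/-- The Dressian `Dr(k, E)`: the points of tropical projective space (indexed by the `k`-element
subsets of `E`) that satisfy the tropical Plücker relations, that is, the valuated matroids of rank
`k` on `E`. -/
def Dressian (k : ℕ) (E : Type*) [DecidableEq E] : Set (TropProj (KSubset k E)) :=
  {μ | Quotient.lift (s := tropProjSetoid (KSubset k E)) (fun v => TropPluckerRel v.1)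
    (fun _ _ hvw => propext
      ⟨tropPluckerRel_of_equiv hvw.choose_spec,
        tropPluckerRel_of_equiv ((tropProjSetoid _).symm hvw).choose_spec⟩) μ}

/-- The symplectic Dressian `SpDr(k, 2n)`: the valuated matroids that satisfy the tropical
symplectic relations. -/
def SymplecticDressian (k n : ℕ) : Set (TropProj (KSubset k (Fin n ⊕ Fin n))) :=
  {μ | μ ∈ Dressian k (Fin n ⊕ Fin n) ∧
    Quotient.lift (s := tropProjSetoid (KSubset k (Fin n ⊕ Fin n)))
      (fun v => TropSymplecticRel v.1)
      (fun _ _ hvw => propext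
        ⟨tropSymplecticRel_of_equiv hvw.choose_spec,
          tropSymplecticRel_of_equiv ((tropProjSetoid _).symm hvw).choose_spec⟩) μ}

/-- The tropical linear space `L_μ ⊆ 𝕋^E`. -/
def tropLinearSpace {k : ℕ} {E : Type*} [DecidableEq E] (μ : TropProj (KSubset k E)) :
    Set (E → TropNum) :=
  Quotient.lift (s := tropProjSetoid (KSubset k E)) (fun v => tropLinSet v.1)
    (fun _ _ hvw => Set.Subset.antisymm
      (tropLinSet_subset_of_equiv hvw.choose_spec)
      (tropLinSet_subset_of_equiv ((tropProjSetoid _).symm hvw).choose_spec)) μ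

/-- Tropical orthogonality in `𝕋^{2n}`: the minimum of the `x_i + y_ī`, over `i ∈ [2n]`, is achieved
at least twice (for `n ≥ 1` this is automatic if the minimum is `∞`). -/
def TropOrthogonal {n : ℕ} (x y : Fin n ⊕ Fin n → TropNum) : Prop :=
  MinTwice Finset.univ (fun i => x i + y (barInv i))

/-- A subset of `𝕋^{2n}` is isotropic if its points are pairwise orthogonal. -/
def TropIsotropic {n : ℕ} (L : Set (Fin n ⊕ Fin n → TropNum)) : Prop :=
  ∀ x ∈ L, ∀ y ∈ L, TropOrthogonal x y

/-! Both conditions are equivalent to self-duality: `v` is invariant under `barCompl`. Self-duality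
turns the vectors `v_{S i}`, which generate the linear space tropically, into the linear forms
cutting it out, hence isotropy. Conversely, isotropy applied to these vectors is an exchange
property between `v` and its dual `v ∘ barCompl`. It forces the two to have a common basis and to
differ by a constant (`TropExchange.exists_common`, `TropExchange.add_eq_add`), and the constant
vanishes because `barCompl` is an involution. The bound `n ≤ 3` enters only in comparing with the
symplectic relations: each then has exactly two terms, swapped by `barCompl`, while an `n`-set
containing no pair `i, ī` is fixed by it. -/

theorem plCoord_eq_top {k : ℕ} {E : Type*} {v : KSubset k E → TropNum} {J : Finset E}
    (h : J.card ≠ k) : plCoord v J = ⊤ := dif_neg h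

theorem card_of_plCoord_ne_top {k : ℕ} {E : Type*} {v : KSubset k E → TropNum} {J : Finset E}
    (h : plCoord v J ≠ ⊤) : J.card = k := by
  by_contra hJ
  exact h (plCoord_eq_top hJ)

theorem exists_plCoord_ne_top {k : ℕ} {E : Type*} {v : KSubset k E → TropNum}
    (hv : ∃ J, v J ≠ ⊤) : ∃ B, plCoord v B ≠ ⊤ := by
  obtain ⟨J, hJ⟩ := hv
  exact ⟨J.1, by simpa [plCoord, J.2] using hJ⟩

/-- If one term of a family with `MinTwice` is finite, some other term is at most as large. -/
theorem MinTwice.exists_ne_le {ι : Type*} {s : Finset ι} {f : ι → TropNum} (h : MinTwice s f)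
    {i : ι} (hi : i ∈ s) (hf : f i ≠ ⊤) : ∃ j ∈ s, j ≠ i ∧ f j ≤ f i := by
  have hle : s.inf f ≤ f i := Finset.inf_le hi
  rcases h with h | ⟨a, ha, b, hb, hab, h1, h2⟩
  · rw [h, top_le_iff] at hle
    exact absurd hle hf
  · by_cases hai : a = i
    · exact ⟨b, hb, fun hbi => hab (hai.trans hbi.symm), h2 ▸ hle⟩
    · exact ⟨a, ha, hai, h1 ▸ hle⟩

theorem minTwice_of_le {ι : Type*} {s : Finset ι} {f : ι → TropNum} {i j : ι} (hi : i ∈ s)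
    (hj : j ∈ s) (hij : i ≠ j) (hmin : ∀ a ∈ s, f i ≤ f a) (hle : f j ≤ f i) : MinTwice s f := by
  have h : f i = s.inf f := le_antisymm (Finset.le_inf hmin) (Finset.inf_le hi)
  exact Or.inr ⟨i, hi, j, hj, hij, h, (le_antisymm hle (hmin j hj)).trans h⟩

theorem minTwice_pair {ι : Type*} [DecidableEq ι] {f : ι → TropNum} {i j : ι} (hij : i ≠ j) :
    MinTwice {i, j} f ↔ f i = f j := by
  constructor
  · intro h
    apply le_antisymm
    · by_cases hj : f j = ⊤
      · simp [hj]
      · obtain ⟨a, ha, hne, hle⟩ := h.exists_ne_le (i := j) (by simp) hj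
        have : a = i := by simpa [hne] using ha
        exact this ▸ hle
    · by_cases hi : f i = ⊤
      · simp [hi]
      · obtain ⟨a, ha, hne, hle⟩ := h.exists_ne_le (i := i) (by simp) hi
        have : a = j := by simpa [hne] using ha
        exact this ▸ hle
  · intro h
    exact minTwice_of_le (by simp) (by simp) hij (by simp [h]) h.ge

/-! ### Generation of a tropical linear space -/

/-- Every point of a tropical linear space is a tropical sum of multiples of the vectors
`(v_{S i})_i`: for each finite coordinate, one of them lies above the point and touches it there. -/
theorem exists_le_const_add_plCoord {k : ℕ} {E : Type*} [Fintype E] [DecidableEq E]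
    {v : KSubset k E → TropNum} (hv : ∃ B, plCoord v B ≠ ⊤) {x : E → TropNum}
    (hx : x ∈ tropLinSet v) {i : E} (hi : x i ≠ ⊤) :
    ∃ S : Finset E, S.card + 1 = k ∧ ∃ c : ℝ,
      (∀ j, x j ≤ c + plCoord v (insert j S)) ∧ x i = c + plCoord v (insert i S) := by
  classical
  set r : E → ℝ := fun j => (x j).untopD 0 with hr
  have hxr : ∀ j, x j ≠ ⊤ → x j = (r j : TropNum) := by
    intro j hj
    lift x j to ℝ using hj with y hy
    simp [hr, ← hy]
  set p : Finset E → ℝ := fun B => (plCoord v B).untopD 0 with hp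
  have hvp : ∀ B, plCoord v B ≠ ⊤ → plCoord v B = (p B : TropNum) := by
    intro B hB
    lift plCoord v B to ℝ using hB with y hy
    simp [hp, ← hy]
  -- A basis minimizing `v_B - ∑ x_j` is wanted. Infinite `x_j` act as arbitrarily large numbers, so
  -- the order is lexicographic: fewest finite coordinates first, then the finite part `W`.
  let N : Finset E → ℕ := fun B => ∑ j ∈ B, if x j = ⊤ then 0 else 1
  let W : Finset E → ℝ := fun B => p B - ∑ j ∈ B, r j
  let IsMin : Finset E → Prop := fun B => plCoord v B ≠ ⊤ ∧
    ∀ B', plCoord v B' ≠ ⊤ → N B < N B' ∨ N B = N B' ∧ W B ≤ W B'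
  obtain ⟨B, hB⟩ : ∃ B, IsMin B := by
    obtain ⟨B, hB, hmin⟩ := Finset.exists_min_image
      (Finset.univ.filter fun B : Finset E => plCoord v B ≠ ⊤) (fun B => toLex (N B, W B))
      (by simpa [Finset.Nonempty] using hv)
    refine ⟨B, by simpa using hB, fun B' hB' => ?_⟩
    simpa [Prod.Lex.toLex_le_toLex] using hmin B' (by simpa using hB')
  -- The linear form of `B ∪ i` allows some `j` to be exchanged for `i` without losing minimality.
  obtain ⟨C, hC, hiC⟩ : ∃ C, IsMin C ∧ i ∈ C := by
    by_cases hiB : i ∈ B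
    · exact ⟨B, hB, hiB⟩
    have hcard : (insert i B).card = k + 1 := by
      rw [Finset.card_insert_of_notMem hiB, card_of_plCoord_ne_top hB.1]
    have hei : (insert i B).erase i = B := Finset.erase_insert hiB
    obtain ⟨j, hj, hji, hle⟩ := (hx (insert i B) hcard).exists_ne_le (i := i) (by simp)
      (by rw [hei]; exact WithTop.add_ne_top.2 ⟨hB.1, hi⟩)
    rw [hei] at hle
    have hfin : plCoord v ((insert i B).erase j) + x j ≠ ⊤ :=
      ne_top_of_le_ne_top (WithTop.add_ne_top.2 ⟨hB.1, hi⟩) hle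
    obtain ⟨h1, h2⟩ := WithTop.add_ne_top.1 hfin
    rw [hvp _ h1, hvp _ hB.1, hxr _ h2, hxr _ hi] at hle
    norm_cast at hle
    have hN := Finset.add_sum_erase (insert i B) (fun j => if x j = ⊤ then 0 else 1) hj
    have hR := Finset.add_sum_erase (insert i B) r hj
    rw [Finset.sum_insert hiB] at hN hR
    simp only [h2, hi, if_false] at hN
    have hN' : N ((insert i B).erase j) = N B := by
      simp only [N]
      omega
    have hW : W ((insert i B).erase j) ≤ W B := by
      simp only [W]
      linarith
    refine ⟨(insert i B).erase j, ⟨h1, fun B' hB' => ?_⟩, by simp [hji.symm]⟩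
    rw [hN']
    rcases hB.2 B' hB' with h | ⟨h, h'⟩
    · exact Or.inl h
    · exact Or.inr ⟨h, hW.trans h'⟩
  have hins : insert i (C.erase i) = C := Finset.insert_erase hiC
  have hCk := card_of_plCoord_ne_top hC.1
  have hSk : (C.erase i).card + 1 = k := by rw [Finset.card_erase_add_one hiC, hCk]
  refine ⟨C.erase i, hSk, r i - p C, fun j => ?_, ?_⟩
  · by_cases hj : plCoord v (insert j (C.erase i)) = ⊤
    · simp [hj]
    have hjS : j ∉ C.erase i := by
      intro h
      have := card_of_plCoord_ne_top hj
      rw [Finset.insert_eq_of_mem h] at this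
      omega
    have hmin := hC.2 _ hj
    have hNC : N C = 1 + N (C.erase i) := by
      simp only [N]
      rw [← Finset.add_sum_erase C _ hiC]
      simp [hi]
    have hWC := Finset.add_sum_erase C r hiC
    have hNj : N (insert j (C.erase i)) = (if x j = ⊤ then 0 else 1) + N (C.erase i) :=
      Finset.sum_insert hjS
    by_cases hxj : x j = ⊤
    · rw [if_pos hxj] at hNj
      omega
    · rw [if_neg hxj] at hNj
      have h : W C ≤ W (insert j (C.erase i)) := by
        rcases hmin with h | h
        · omega
        · exact h.2
      simp only [W, Finset.sum_insert hjS] at h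
      rw [hxr j hxj, hvp _ hj]
      norm_cast
      linarith
  · rw [hins, hvp _ hC.1, hxr i hi]
    norm_cast
    ring

/-! ### Barred complements; self-duality implies isotropy -/

theorem barInv_barInv {n : ℕ} (i : Fin n ⊕ Fin n) : barInv (barInv i) = i := Sum.swap_swap i

/-- The barred complement of a subset of `[2n]`. -/
def barCompl {n : ℕ} (J : Finset (Fin n ⊕ Fin n)) : Finset (Fin n ⊕ Fin n) :=
  Jᶜ.image barInv

theorem mem_barCompl {n : ℕ} {J : Finset (Fin n ⊕ Fin n)} {i : Fin n ⊕ Fin n} :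
    i ∈ barCompl J ↔ barInv i ∉ J := by
  simp only [barCompl, Finset.mem_image, Finset.mem_compl]
  constructor
  · rintro ⟨a, ha, rfl⟩
    rwa [barInv_barInv]
  · exact fun h => ⟨barInv i, h, barInv_barInv i⟩

theorem barCompl_barCompl {n : ℕ} (J : Finset (Fin n ⊕ Fin n)) : barCompl (barCompl J) = J := by
  ext i
  simp [mem_barCompl, barInv_barInv]

theorem card_barCompl_add_card {n : ℕ} (J : Finset (Fin n ⊕ Fin n)) :
    (barCompl J).card + J.card = n + n := by
  rw [barCompl, Finset.card_image_of_injective _ (Function.LeftInverse.injective barInv_barInv),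
    Finset.card_compl_add_card]
  simp

theorem barCompl_insert {n : ℕ} (i : Fin n ⊕ Fin n) (J : Finset (Fin n ⊕ Fin n)) :
    barCompl (insert i J) = (barCompl J).erase (barInv i) := by
  ext a
  have : barInv a = i ↔ a = barInv i :=
    ⟨fun h => by rw [← h, barInv_barInv], fun h => by rw [h, barInv_barInv]⟩
  simp [mem_barCompl, this]

theorem tropIsotropic_of_plCoord_barCompl {n : ℕ} {v : KSubset n (Fin n ⊕ Fin n) → TropNum}
    (hv : ∃ B, plCoord v B ≠ ⊤) (hdual : ∀ J, plCoord v (barCompl J) = plCoord v J) :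
    TropIsotropic (tropLinSet v) := by
  intro x hx y hy
  by_cases htop : Finset.univ.inf (fun i => x i + y (barInv i)) = ⊤
  · exact Or.inl htop
  have hne : (Finset.univ : Finset (Fin n ⊕ Fin n)).Nonempty := by
    rw [Finset.nonempty_iff_ne_empty]
    intro h
    rw [h] at htop
    exact htop rfl
  obtain ⟨i, -, hi⟩ := Finset.exists_mem_eq_inf _ hne (fun i => x i + y (barInv i))
  have hmin : ∀ a, x i + y (barInv i) ≤ x a + y (barInv a) := fun a =>
    hi ▸ Finset.inf_le (Finset.mem_univ a)
  rw [hi] at htop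
  obtain ⟨hxi, hyi⟩ := WithTop.add_ne_top.1 htop
  -- Replacing `y` by a generator above it that touches it at `ī` reduces the claim to the linear
  -- form of `barCompl S` at `x`.
  obtain ⟨S, hS, c, hle, heq⟩ := exists_le_const_add_plCoord hv hy hyi
  have hcoord : ∀ j, plCoord v (insert (barInv j) S) = plCoord v ((barCompl S).erase j) := by
    intro j
    rw [← hdual, barCompl_insert, barInv_barInv]
  simp only [hcoord] at heq
  have hiS : plCoord v ((barCompl S).erase i) ≠ ⊤ := by
    intro h
    rw [h] at heq
    exact hyi (by simpa using heq)
  have hcard : (barCompl S).card = n + 1 := by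
    have := card_barCompl_add_card S
    omega
  have hmem : i ∈ barCompl S := by
    by_contra h
    rw [Finset.erase_eq_of_notMem h] at hiS
    have := card_of_plCoord_ne_top hiS
    omega
  obtain ⟨j, -, hji, hj⟩ := (hx (barCompl S) hcard).exists_ne_le hmem
    (WithTop.add_ne_top.2 ⟨hiS, hxi⟩)
  refine minTwice_of_le (Finset.mem_univ i) (Finset.mem_univ j) hji.symm (fun a _ => hmin a) ?_
  calc x j + y (barInv j)
      ≤ x j + (c + plCoord v ((barCompl S).erase j)) := by
        rw [← hcoord]
        gcongr
        exact hle _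
    _ = c + (plCoord v ((barCompl S).erase j) + x j) := by
        rw [add_comm, add_assoc]
    _ ≤ c + (plCoord v ((barCompl S).erase i) + x i) := by gcongr
    _ = x i + y (barInv i) := by rw [heq, ← add_assoc, add_comm]

/-! ### Exchange properties; isotropy implies self-duality -/

/-- The vectors `(v_{S i})_i` belong to the tropical linear space. -/
theorem TropPluckerRel.plCoord_insert_mem {k : ℕ} {E : Type*} [DecidableEq E]
    {v : KSubset k E → TropNum} (hv : TropPluckerRel v) {S : Finset E} (hS : S.card + 1 = k) :
    (fun i => plCoord v (insert i S)) ∈ tropLinSet v := by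
  intro T hT
  have h := hv S T hS hT
  have htop : ∀ a ∈ S, plCoord v (insert a S) = ⊤ := fun a ha =>
    plCoord_eq_top (by rw [Finset.insert_eq_of_mem ha]; omega)
  have hinf : T.inf (fun i => plCoord v (T.erase i) + plCoord v (insert i S)) =
      (T \ S).inf (fun i => plCoord v (T.erase i) + plCoord v (insert i S)) := by
    apply le_antisymm
    · exact Finset.inf_mono Finset.sdiff_subset
    · refine Finset.le_inf fun a ha => ?_
      by_cases haS : a ∈ S
      · simp [htop a haS]
      · exact Finset.inf_le (Finset.mem_sdiff.2 ⟨ha, haS⟩)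
  unfold MinTwice
  rw [hinf]
  rcases h with h | ⟨i, hi, j, hj, h⟩
  · exact Or.inl h
  · exact Or.inr ⟨i, (Finset.mem_sdiff.1 hi).1, j, (Finset.mem_sdiff.1 hj).1, h⟩

/-- The symmetric exchange property for a pair of functions on finite sets. -/
def TropExchange {E : Type*} [DecidableEq E] (f g : Finset E → TropNum) : Prop :=
  ∀ A B : Finset E, f A ≠ ⊤ → g B ≠ ⊤ → ∀ i ∈ A \ B, ∃ j ∈ B \ A,
    f (insert j (A.erase i)) + g ((insert i B).erase j) ≤ f A + g B

theorem TropPluckerRel.tropExchange {k : ℕ} {E : Type*} [DecidableEq E]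
    {v : KSubset k E → TropNum} (hv : TropPluckerRel v) :
    TropExchange (plCoord v) (plCoord v) := by
  intro A B hA hB i hi
  obtain ⟨hiA, hiB⟩ := Finset.mem_sdiff.1 hi
  have hS : (A.erase i).card + 1 = k := by
    rw [Finset.card_erase_add_one hiA, card_of_plCoord_ne_top hA]
  have hT : (insert i B).card = k + 1 := by
    rw [Finset.card_insert_of_notMem hiB, card_of_plCoord_ne_top hB]
  have hei : (insert i B).erase i = B := Finset.erase_insert hiB
  have hie : insert i (A.erase i) = A := Finset.insert_erase hiA
  obtain ⟨j, hj, hji, hle⟩ := (hv _ _ hS hT).exists_ne_le (i := i) (by simp)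
    (by rw [hei, hie]; exact WithTop.add_ne_top.2 ⟨hB, hA⟩)
  rw [hei, hie] at hle
  refine ⟨j, ?_, ?_⟩
  · simpa [hji] using hj
  · rwa [add_comm, add_comm (plCoord v A)]

theorem barCompl_erase {n : ℕ} (i : Fin n ⊕ Fin n) (J : Finset (Fin n ⊕ Fin n)) :
    barCompl (J.erase i) = insert (barInv i) (barCompl J) := by
  rw [← barCompl_barCompl (insert _ _), barCompl_insert, barCompl_barCompl, barInv_barInv]

/-- Orthogonality of the generators for `A ∖ i` and `barCompl (B ∪ i)` is exactly this exchange;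
finiteness of the competing term places `j` in `B ∖ A`. -/
theorem TropPluckerRel.tropExchange_barCompl {n : ℕ} {v : KSubset n (Fin n ⊕ Fin n) → TropNum}
    (hv : TropPluckerRel v) (hiso : TropIsotropic (tropLinSet v)) :
    TropExchange (plCoord v) (fun J => plCoord v (barCompl J)) := by
  intro A B hA hB i hi
  obtain ⟨hiA, hiB⟩ := Finset.mem_sdiff.1 hi
  have hS : (A.erase i).card + 1 = n := by
    rw [Finset.card_erase_add_one hiA, card_of_plCoord_ne_top hA]
  have hBn : B.card = n := by
    have := card_of_plCoord_ne_top hB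
    have := card_barCompl_add_card B
    omega
  have hT : (insert i B).card = n + 1 := by rw [Finset.card_insert_of_notMem hiB, hBn]
  have hS' : (barCompl (insert i B)).card + 1 = n := by
    have := card_barCompl_add_card (insert i B)
    omega
  have hei : (insert i B).erase i = B := Finset.erase_insert hiB
  have hie : insert i (A.erase i) = A := Finset.insert_erase hiA
  have h := hiso _ (hv.plCoord_insert_mem hS) _ (hv.plCoord_insert_mem hS')
  unfold TropOrthogonal at h
  simp only [← barCompl_erase] at h
  have hfin : plCoord v A + plCoord v (barCompl B) ≠ ⊤ := WithTop.add_ne_top.2 ⟨hA, hB⟩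
  obtain ⟨j, -, hji, hle⟩ := h.exists_ne_le (Finset.mem_univ i) (by rwa [hei, hie])
  rw [hei, hie] at hle
  obtain ⟨h1, h2⟩ := WithTop.add_ne_top.1 (ne_top_of_le_ne_top hfin hle)
  have hjA : j ∉ A.erase i := by
    intro hj
    have := card_of_plCoord_ne_top h1
    rw [Finset.insert_eq_of_mem hj] at this
    omega
  have hjB : j ∈ insert i B := by
    by_contra hj
    have := card_of_plCoord_ne_top h2
    rw [Finset.erase_eq_of_notMem hj] at this
    omega
  refine ⟨j, ?_, hle⟩
  simp only [Finset.mem_erase, hji, Finset.mem_insert, false_or, ne_eq, not_false_iff,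
    true_and] at hjA hjB
  exact Finset.mem_sdiff.2 ⟨hjB, hjA⟩

theorem card_exchange_sdiff_lt {E : Type*} [DecidableEq E] {A B : Finset E} {i j : E}
    (hi : i ∈ A \ B) (hj : j ∈ B \ A) : (insert j (A.erase i) \ B).card < (A \ B).card := by
  refine Finset.card_lt_card (Finset.ssubset_iff_of_subset ?_ |>.2 ⟨i, hi, ?_⟩)
  · intro a
    grind
  · grind

/-- With `B` fixed, each exchange moves `A` closer to `B` and keeps `f` finite. -/
theorem TropExchange.exists_common {E : Type*} [DecidableEq E] {f g : Finset E → TropNum} {k : ℕ}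
    (hf : ∀ A, f A ≠ ⊤ → A.card = k) (hg : ∀ A, g A ≠ ⊤ → A.card = k) (h : TropExchange f g)
    {B : Finset E} (hB : g B ≠ ⊤) :
    ∀ (d : ℕ) (A : Finset E), f A ≠ ⊤ → (A \ B).card = d → ∃ C, f C ≠ ⊤ ∧ g C ≠ ⊤ := by
  intro d
  induction d using Nat.strong_induction_on with
  | _ d ih =>
    intro A hA hd
    rcases (A \ B).eq_empty_or_nonempty with he | ⟨i, hi⟩
    · have hAB : A = B := Finset.eq_of_subset_of_card_le (Finset.sdiff_eq_empty_iff_subset.1 he)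
        (by rw [hf A hA, hg B hB])
      exact ⟨A, hA, hAB ▸ hB⟩
    · obtain ⟨j, hj, hle⟩ := h A B hA hB i hi
      have hfin := ne_top_of_le_ne_top (WithTop.add_ne_top.2 ⟨hA, hB⟩) hle
      exact ih _ (hd ▸ card_exchange_sdiff_lt hi hj) _ (WithTop.add_ne_top.1 hfin).1 rfl

/-- Under `TropExchange f g`, the difference `f - g` agrees on neighbours in the exchange graph. -/
theorem TropExchange.neighbour_le {E : Type*} [DecidableEq E] {f g : Finset E → TropNum}
    (h : TropExchange f g) {A : Finset E} {i j : E} (hi : i ∈ A) (hj : j ∉ A)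
    (hA : f A ≠ ⊤) (hA' : g (insert j (A.erase i)) ≠ ⊤) :
    f (insert j (A.erase i)) + g A ≤ f A + g (insert j (A.erase i)) := by
  have hij : i ≠ j := fun h => hj (h ▸ hi)
  -- The second set has only `j` outside `A`, so the exchange is forced.
  obtain ⟨a, ha, hle⟩ := h A (insert j (A.erase i)) hA hA' i (by simp [hi, hij])
  have haj : a = j := by
    grind
  subst haj
  have : (insert i (insert a (A.erase i))).erase a = A := by
    grind
  rwa [this] at hle

/-- Exchanges within `f` join `A` to `C` through neighbours; comparing each step in both directions
keeps `f - g` constant and `g` finite. -/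
theorem TropExchange.add_eq_add {E : Type*} [DecidableEq E] {f g : Finset E → TropNum} {k : ℕ}
    (hf : ∀ A, f A ≠ ⊤ → A.card = k) (hff : TropExchange f f) (h : TropExchange f g)
    {C : Finset E} (hC : f C ≠ ⊤) (hC' : g C ≠ ⊤) :
    ∀ (d : ℕ) (A : Finset E), f A ≠ ⊤ → (A \ C).card = d → f A + g C = f C + g A := by
  intro d
  induction d using Nat.strong_induction_on with
  | _ d ih =>
    intro A hA hd
    rcases (A \ C).eq_empty_or_nonempty with he | ⟨i, hi⟩
    · have hAC : A = C := Finset.eq_of_subset_of_card_le (Finset.sdiff_eq_empty_iff_subset.1 he)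
        (by rw [hf A hA, hf C hC])
      rw [hAC]
    · obtain ⟨j, hj, hle⟩ := hff A C hA hC i hi
      have hfin := ne_top_of_le_ne_top (WithTop.add_ne_top.2 ⟨hA, hC⟩) hle
      have hA' := (WithTop.add_ne_top.1 hfin).1
      have heq := ih _ (hd ▸ card_exchange_sdiff_lt hi hj) _ hA' rfl
      have hiA := (Finset.mem_sdiff.1 hi).1
      have hjA := (Finset.mem_sdiff.1 hj).2
      have hij : i ≠ j := fun h => hjA (h ▸ hiA)
      have hback : insert i ((insert j (A.erase i)).erase j) = A := by
        rw [Finset.erase_insert (by simp [hjA]), Finset.insert_erase hiA]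
      have hgA' : g (insert j (A.erase i)) ≠ ⊤ :=
        (WithTop.add_ne_top.1 (heq ▸ WithTop.add_ne_top.2 ⟨hA', hC'⟩)).2
      have h1 := h.neighbour_le hiA hjA hA hgA'
      have hgA : g A ≠ ⊤ := (WithTop.add_ne_top.1
        (ne_top_of_le_ne_top (WithTop.add_ne_top.2 ⟨hA, hgA'⟩) h1)).2
      have h2 := h.neighbour_le (A := insert j (A.erase i)) (i := j) (j := i) (by simp)
        (by simp [hij]) hA' (by rwa [hback])
      rw [hback] at h2
      generalize insert j (A.erase i) = A' at *
      lift f A to ℝ using hA with a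
      lift g A to ℝ using hgA with b
      lift f A' to ℝ using hA' with a'
      lift g A' to ℝ using hgA' with b'
      lift f C to ℝ using hC with c
      lift g C to ℝ using hC' with c'
      norm_cast at *
      linarith

theorem plCoord_barCompl_of_tropIsotropic {n : ℕ} {v : KSubset n (Fin n ⊕ Fin n) → TropNum}
    (hne : ∃ B, plCoord v B ≠ ⊤) (hv : TropPluckerRel v) (hiso : TropIsotropic (tropLinSet v))
    (J : Finset (Fin n ⊕ Fin n)) : plCoord v (barCompl J) = plCoord v J := by
  have hex := hv.tropExchange_barCompl hiso
  have hcard : ∀ A, plCoord v A ≠ ⊤ → A.card = n := fun A => card_of_plCoord_ne_top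
  obtain ⟨C, hC, hC'⟩ : ∃ C, plCoord v C ≠ ⊤ ∧ plCoord v (barCompl C) ≠ ⊤ := by
    obtain ⟨A, hA⟩ := hne
    refine hex.exists_common hcard (fun B hB => ?_) (B := barCompl A)
      (by simpa only [barCompl_barCompl]) _ A hA rfl
    have := hcard _ hB
    have := card_barCompl_add_card B
    omega
  have key : ∀ A, plCoord v A ≠ ⊤ →
      plCoord v A + plCoord v (barCompl C) = plCoord v C + plCoord v (barCompl A) :=
    fun A hA => TropExchange.add_eq_add hcard hv.tropExchange hex hC hC' _ A hA rfl
  -- At `barCompl C`, `key` says that twice the two values agree.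
  have hCC : plCoord v (barCompl C) = plCoord v C := by
    have := key _ hC'
    rw [barCompl_barCompl] at this
    lift plCoord v C to ℝ using hC with c
    lift plCoord v (barCompl C) to ℝ using hC' with c'
    norm_cast at *
    linarith
  have hfix : ∀ A, plCoord v A ≠ ⊤ → plCoord v (barCompl A) = plCoord v A := by
    intro A hA
    have := key A hA
    rw [hCC, add_comm] at this
    exact ((WithTop.add_left_inj hC).1 this).symm
  by_cases hJ : plCoord v J = ⊤
  · by_contra h
    have h' := hfix (barCompl J) (fun h' => h (h'.trans hJ.symm))
    rw [barCompl_barCompl] at h'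
    exact h h'.symm
  · exact hfix J hJ

/-! ### The symplectic relations for `n ≤ 3` -/

theorem exists_pair_of_card_add_two {n : ℕ} (hn : n ≤ 3) (S : Finset (Fin n ⊕ Fin n))
    (hS : S.card + 2 = n) : ∃ i j : Fin n, i ≠ j ∧
      ({a : Fin n | Sum.inl a ∉ S ∧ barInv (Sum.inl a) ∉ S} : Finset (Fin n)) = {i, j} ∧
      barCompl (insert (Sum.inl i) (insert (barInv (Sum.inl i)) S)) =
        insert (Sum.inl j) (insert (barInv (Sum.inl j)) S) := by
  revert S
  interval_cases n <;> decide

theorem barCompl_eq_or_exists_pair {n : ℕ} (hn : n ≤ 3) (J : Finset (Fin n ⊕ Fin n))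
    (hJ : J.card = n) : barCompl J = J ∨ ∃ S : Finset (Fin n ⊕ Fin n), S.card + 2 = n ∧
      ∃ i : Fin n, (Sum.inl i ∉ S ∧ barInv (Sum.inl i) ∉ S) ∧
        J = insert (Sum.inl i) (insert (barInv (Sum.inl i)) S) := by
  -- Eliminating `S` leaves a small finite check for `decide`.
  suffices h : ∀ J : Finset (Fin n ⊕ Fin n), J.card = n → barCompl J = J ∨
      ∃ i : Fin n, Sum.inl i ∈ J ∧ barInv (Sum.inl i) ∈ J by
    rcases h J hJ with h | ⟨i, h1, h2⟩
    · exact Or.inl h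
    · have h2' : barInv (Sum.inl i) ∈ J.erase (Sum.inl i) := by
        simpa [barInv] using h2
      refine Or.inr ⟨(J.erase (Sum.inl i)).erase (barInv (Sum.inl i)), ?_, i, by simp, ?_⟩
      · have := Finset.card_erase_add_one h1
        have := Finset.card_erase_add_one h2'
        omega
      · rw [Finset.insert_erase h2', Finset.insert_erase h1]
  clear hJ J
  interval_cases n <;> decide

theorem tropSymplecticRel_iff_plCoord_barCompl {n : ℕ} (hn : n ≤ 3)
    (v : KSubset n (Fin n ⊕ Fin n) → TropNum) :
    TropSymplecticRel v ↔ ∀ J, plCoord v (barCompl J) = plCoord v J := by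
  constructor
  · intro h J
    by_cases hJ : J.card = n
    · rcases barCompl_eq_or_exists_pair hn J hJ with hJ | ⟨S, hS, a, ha, rfl⟩
      · rw [hJ]
      · obtain ⟨i, j, hij, hset, hbar⟩ := exists_pair_of_card_add_two hn S hS
        have hrel := h S hS
        have hmem : a ∈ ({i, j} : Finset (Fin n)) := by
          rw [← hset]
          simpa using ha
        rw [hset, minTwice_pair hij] at hrel
        rcases Finset.mem_insert.1 hmem with rfl | hmem
        · rw [hbar, hrel]
        · rw [Finset.mem_singleton.1 hmem, ← hrel, ← hbar, barCompl_barCompl]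
    · rw [plCoord_eq_top hJ, plCoord_eq_top]
      have := card_barCompl_add_card J
      omega
  · intro h S hS
    obtain ⟨i, j, hij, hset, hbar⟩ := exists_pair_of_card_add_two hn S hS
    rw [hset, minTwice_pair hij, ← hbar, h]

theorem proposition4p6 (n : ℕ) (hn : n ≤ 3) (μ : TropProj (KSubset n (Fin n ⊕ Fin n)))
    (hμ : μ ∈ Dressian n (Fin n ⊕ Fin n)) :
    TropIsotropic (tropLinearSpace μ) ↔ μ ∈ SymplecticDressian n n := by
  induction μ using Quotient.inductionOn with
  | h v =>
    have hv : TropPluckerRel v.1 := hμ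
    have hne := exists_plCoord_ne_top v.2
    constructor
    · intro hiso
      exact ⟨hμ, (tropSymplecticRel_iff_plCoord_barCompl hn v.1).2
        (plCoord_barCompl_of_tropIsotropic hne hv hiso)⟩
    · intro h
      exact tropIsotropic_of_plCoord_barCompl hne
        ((tropSymplecticRel_iff_plCoord_barCompl hn v.1).1 h.2)
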